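/- **Setting.** A *BSR(BD) clause* is a clause $\Lambda \,\|\, \Gamma \to \Delta$, read as the universal closure of $(\bigwedge\Lambda\wedge\bigwedge\Gamma)\to\bigvee\Delta$, where $\Lambda$ is a finite multiset of constraints $x \triangleleft c$, $x\triangleleft y$, $x-y\triangleleft c$ over real-valued variables $x,y$ with $c\in\mathbb{Q}$ and $\triangleleft\in\{<,\le,=,\ne,\ge,>\}$, such that for each $x-y\triangleleft c$ in $\Lambda$ both $x$ and $y$ have a rational lower bound $c'\le\cdot$ and a rational upper bound $\cdot\le d'$ in $\Lambda$; $\Gamma,\Delta$ are finite multisets of equations between free-sort variables and constants and of well-sorted atoms $P(s_1,\dots,s_m)$ over real-valued variables, free-sort variables and free-sort constants. Interpretations interpret the base sort by $\mathbb{R}$ and the free sort by an arbitrary nonempty domain. A *timed automaton* $\mathbf{A}=\langle \mathrm{Loc},\ell_0,\bar x,(\mathrm{inv}_\ell)_{\ell\in \mathrm{Loc}},\mathcal{T}\rangle$ has a finite set $\mathrm{Loc}$ of locations, an initial location $\ell_0$, a finite tuple $\bar x$ of $n$ clocks, a clock constraint $\mathrm{inv}_\ell$ for each location, and a finite set $\mathcal{T}$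 of transitions $\langle\ell,g,Z,\ell'\rangle$ with guard $g$ and set $Z$ of clocks to be reset; clock constraints are finite conjunctions of constraints $\mathtt{true}$, $x\triangleleft c$, $x-y\triangleleft c$ with $c\in\mathbb{Z}$. States are pairs $\langle \ell,\bar r\rangle$ with $\bar r\in[0,\infty)^n$. The steps are $\langle\ell,\bar r\rangle\hookrightarrow\langle\ell,\bar r+t\rangle$ with $t\ge 0$ and $\bar r+t\models \mathrm{inv}_\ell$, and $\langle\ell,\bar r\rangle\hookrightarrow\langle\ell',\bar r[Z\mapsto0]\rangle$ for $\langle\ell,g,Z,\ell'\rangle\in\mathcal{T}$ with $\bar r\models g$ and $\bar r[Z\mapsto 0]\models\mathrm{inv}_{\ell'}$. The initial configuration is $\langle\ell_0,\bar 0\rangle$, provided that $\bar 0\models\mathrm{inv}_{\ell_0}$ (otherwise no state is reachable). **Encoding.** For $\lambda\in\mathbb{N}$ let $N_{\mathbf{A},\lambda}$ be the following set of clauses, in which the locations are free-sort constants and $\mathrm{Reach}$ is a $(1+n)$-ary predicate symbol, and where $0\le x$ and $x<\lambda+1$ (and the redundant $x\le\lambda+1$) are added to the constraint part for every real-valued variable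 $x$ of the clause: * the initial clause $\bigwedge_{x\in\bar x} x=0\wedge\mathrm{inv}_{\ell_0}[\bar x]\,\|\,\to\mathrm{Reach}(\ell_0,\bar x)$; * for each $\ell\in\mathrm{Loc}$, the clauses obtained from $$\bigwedge_{x_1,x_2\in\bar x}\ \bigwedge_{-\lambda\le k\le\lambda}\bigl(x_1-x_2\le k\leftrightarrow x_1'-x_2'\le k\bigr)\wedge\bigl(x_1-x_2\ge k\leftrightarrow x_1'-x_2'\ge k\bigr)\ \wedge\bigwedge_{x\in\bar x}x'\ge x\wedge\mathrm{inv}_\ell[\bar x']\ \|\ \mathrm{Reach}(\ell,\bar x)\to\mathrm{Reach}(\ell,\bar x')$$ by splitting each equivalence into the two cases "both sides true" and "both sides false"; * for each $\langle\ell,g,Z,\ell'\rangle\in\mathcal{T}$, the clause $g[\bar x]\wedge\bigwedge_{x\in Z}x'=0\wedge\bigwedge_{x\in\bar x\setminus Z}x'=x\wedge\mathrm{inv}_{\ell'}[\bar x']\,\|\,\mathrm{Reach}(\ell,\bar x)\to\mathrm{Reach}(\ell',\bar x')$. **Theorem.** Let $\mathbf{A}$ be a timed automaton with $n$ clocks,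 $\ell$ a location, $\psi$ a clock constraint, and let $K$ be the maximal absolute value of an integer constant occurring in the invariants and guards of $\mathbf{A}$ or in $\psi$ ($K=0$ if there is none). Then for every integer $$\lambda\ \ge\ |\mathrm{Loc}|\cdot(2K+2)^n\cdot(4K+3)^{n^2}\cdot(K+1)$$ the clause set $N:=N_{\mathbf{A},\lambda}\cup\{\psi[\bar x]\wedge\bigwedge_{x\in\bar x}(0\le x\wedge x<\lambda+1\wedge x\le\lambda+1)\,\|\,\mathrm{Reach}(\ell,\bar x)\to\Box\}$ is a finite set of BSR(BD) clauses, and $\mathbf{A}$ can reach, from its initial configuration, some state $\langle\ell,\bar r\rangle$ with $\bar r\models\psi$ if and only if $N$ is unsatisfiable. -/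

import Mathlib

/-! ### BSR clauses with bounded difference constraints

The base sort is interpreted by `ℝ`; there is a single free sort.  Base-sort and free-sort
variables are both indexed by `ℕ`. -/

/-- The relation symbols `<, ≤, =, ≠, ≥, >` of linear arithmetic. -/
inductive LARel
  | lt | le | eq | ne | ge | gt

/-- The standard interpretation of the relation symbols over the reals. -/
def LARel.Holds : LARel → ℝ → ℝ → Prop
  | .lt, a, b => a < b
  | .le, a, b => a ≤ b
  | .eq, a, b => a = b
  | .ne, a, b => a ≠ b
  | .ge, a, b => a ≥ b
  | .gt, a, b => a > b

/-- The two sorts: the base sort (reals) and the free sort. -/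
inductive Srt
  | base | free

/-- The carrier of a sort, for a given domain of the free sort. -/
def Srt.Carrier (Dom : Type) : Srt → Type
  | .base => ℝ
  | .free => Dom

/-- A signature: finitely many free-sort constant symbols and finitely many free predicate symbols
with sorted argument positions.  (BSR(BD) clauses contain no base-sort Skolem constants.) -/
structure Signature where
  /-- free-sort constant symbols -/
  Const : Type
  /-- free predicate symbols -/
  Pred : Type
  finite_const : Finite Const
  finite_pred : Finite Pred
  arity : Pred → ℕ
  sort : (P : Pred) → Fin (arity P) → Srt

/-- The terms admitted in the free part of a clause: base-sort variables, free-sort variables,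
and free-sort constant symbols. -/
inductive FreeTerm (Ω : Type) : Srt → Type
  | bvar (x : ℕ) : FreeTerm Ω Srt.base
  | fvar (y : ℕ) : FreeTerm Ω Srt.free
  | const (c : Ω) : FreeTerm Ω Srt.free

/-- The (well-sorted) atoms of the free part of a clause. -/
inductive FreeAtom (S : Signature)
  | eq (s t : FreeTerm S.Const Srt.free)
  | pred (P : S.Pred) (args : (i : Fin (S.arity P)) → FreeTerm S.Const (S.sort P i))

/-- The arithmetic atoms `x ◁ c`, `x ◁ y`, `x - y ◁ c` with base-sort variables `x`, `y` and a
rational constant `c`.  The constraint `c ≤ x` is the atom `x ≥ c`. -/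
inductive BDAtom
  | cst (x : ℕ) (r : LARel) (c : ℚ)
  | var (x : ℕ) (r : LARel) (y : ℕ)
  | diff (x y : ℕ) (r : LARel) (c : ℚ)

/-- A clause `Λ ‖ Γ → Δ` all of whose arithmetic atoms have one of the above forms. -/
structure BDClause (S : Signature) where
  /-- the constraint part `Λ` -/
  arith : Multiset BDAtom
  /-- the antecedent `Γ` -/
  ante : Multiset (FreeAtom S)
  /-- the succedent `Δ` -/
  succ : Multiset (FreeAtom S)

/-- The variable `x` has a rational lower and a rational upper bound in the constraint part. -/
def BDClause.Bounds {S : Signature} (C : BDClause S) (x : ℕ) : Prop :=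
  (∃ c : ℚ, BDAtom.cst x .ge c ∈ C.arith) ∧ (∃ d : ℚ, BDAtom.cst x .le d ∈ C.arith)

/-- BSR(BD) clauses: both variables of every difference constraint `x - y ◁ c` are bounded from
below and above by atoms of the constraint part. -/
def BDClause.IsBSRBD {S : Signature} (C : BDClause S) : Prop :=
  ∀ (x y : ℕ) (r : LARel) (c : ℚ), BDAtom.diff x y r c ∈ C.arith → C.Bounds x ∧ C.Bounds y

/-- A hierarchic interpretation: a nonempty domain of the free sort, with an interpretation of the
free constant symbols and of the free predicate symbols. -/
structure Interp (S : Signature) where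
  Dom : Type
  nonempty : Nonempty Dom
  const : S.Const → Dom
  pred : (P : S.Pred) → Set ((i : Fin (S.arity P)) → (S.sort P i).Carrier Dom)

namespace Interp

variable {S : Signature} (I : Interp S)

/-- Value of a term under the variable assignment `βR` (base sort), `βS` (free sort). -/
def term (βR : ℕ → ℝ) (βS : ℕ → I.Dom) : {s : Srt} → FreeTerm S.Const s → s.Carrier I.Dom
  | _, .bvar x => βR x
  | _, .fvar y => βS y
  | _, .const c => I.const c

/-- Truth of a free atom. -/
def freeAtom (βR : ℕ → ℝ) (βS : ℕ → I.Dom) : FreeAtom S → Prop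
  | .eq s t => I.term βR βS s = I.term βR βS t
  | .pred P args => (fun i => I.term βR βS (args i)) ∈ I.pred P

end Interp

/-- Truth of an arithmetic atom under an assignment of the base-sort variables. -/
def BDAtom.Holds (βR : ℕ → ℝ) : BDAtom → Prop
  | .cst x r c => r.Holds (βR x) (c : ℝ)
  | .var x r y => r.Holds (βR x) (βR y)
  | .diff x y r c => r.Holds (βR x - βR y) (c : ℝ)

/-- `I ⊨ C`: the universal closure of `⋀Λ ∧ ⋀Γ → ⋁Δ` is true in `I`. -/
def Interp.Models {S : Signature} (I : Interp S) (C : BDClause S) : Prop :=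
  ∀ (βR : ℕ → ℝ) (βS : ℕ → I.Dom),
    (∀ a ∈ C.arith, a.Holds βR) → (∀ a ∈ C.ante, I.freeAtom βR βS a) →
      ∃ a ∈ C.succ, I.freeAtom βR βS a

/-- A clause set is satisfiable if it has a hierarchic model. -/
def ClauseSetSatisfiable {S : Signature} (N : Set (BDClause S)) : Prop :=
  ∃ I : Interp S, ∀ C ∈ N, I.Models C

/-! ### Timed automata -/

/-- Atomic clock constraints `true`, `x ◁ c`, `x - y ◁ c` over `n` clocks, `c` an integer. -/
inductive ClockAtom (n : ℕ)
  | tt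
  | cst (x : Fin n) (r : LARel) (c : ℤ)
  | diff (x y : Fin n) (r : LARel) (c : ℤ)

/-- Clock constraints: finite conjunctions of atomic clock constraints. -/
abbrev ClockConstraint (n : ℕ) := List (ClockAtom n)

/-- Truth of an atomic clock constraint under a clock valuation. -/
def ClockAtom.Holds {n : ℕ} (v : Fin n → ℝ) : ClockAtom n → Prop
  | .tt => True
  | .cst x r c => r.Holds (v x) (c : ℝ)
  | .diff x y r c => r.Holds (v x - v y) (c : ℝ)

/-- `[x̄ ↦ v] ⊨ ψ`. -/
def ClockConstraint.Holds {n : ℕ} (ψ : ClockConstraint n) (v : Fin n → ℝ) : Prop :=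
  ∀ a ∈ ψ, a.Holds v

/-- The absolute value of the integer constant of an atom (`0` if there is none). -/
def ClockAtom.absConst {n : ℕ} : ClockAtom n → ℕ
  | .tt => 0
  | .cst _ _ c => c.natAbs
  | .diff _ _ _ c => c.natAbs

/-- The maximal absolute value of an integer constant occurring in `ψ`. -/
def ClockConstraint.maxConst {n : ℕ} (ψ : ClockConstraint n) : ℕ :=
  (ψ.map ClockAtom.absConst).foldr max 0

/-- A location transition: source, guard, set of clocks to be reset, target. -/
structure TATransition (Loc : Type) (n : ℕ) where
  src : Loc
  guard : ClockConstraint n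
  reset : Finset (Fin n)
  dst : Loc

/-- A timed automaton with the (finite) set `Loc` of locations and `n` clocks. -/
structure TimedAutomaton (Loc : Type) (n : ℕ) where
  init : Loc
  inv : Loc → ClockConstraint n
  trans : Finset (TATransition Loc n)

namespace TimedAutomaton

variable {Loc : Type} {n : ℕ} (A : TimedAutomaton Loc n)

/-- Delay transitions and location transitions between states. -/
inductive Step : Loc × (Fin n → ℝ) → Loc × (Fin n → ℝ) → Prop
  | delay (l : Loc) (v : Fin n → ℝ) (t : ℝ) (ht : 0 ≤ t)
      (hinv : (A.inv l).Holds (fun i => v i + t)) :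
      Step (l, v) (l, fun i => v i + t)
  | location (τ : TATransition Loc n) (hτ : τ ∈ A.trans) (v : Fin n → ℝ)
      (hguard : τ.guard.Holds v)
      (hinv : (A.inv τ.dst).Holds (fun i => if i ∈ τ.reset then 0 else v i)) :
      Step (τ.src, v) (τ.dst, fun i => if i ∈ τ.reset then 0 else v i)

/-- `A` reaches the state `⟨l, v⟩`.  The initial configuration is the initial location with all
clocks `0`, subject to the invariant of the initial location. -/
def Reaches (l : Loc) (v : Fin n → ℝ) : Prop :=
  (A.inv A.init).Holds (fun _ => 0) ∧
    Relation.ReflTransGen A.Step (A.init, fun _ => 0) (l, v)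

/-- `A` reaches some state at location `l` whose clock valuation satisfies `ψ`. -/
def CanReach (l : Loc) (ψ : ClockConstraint n) : Prop :=
  ∃ v : Fin n → ℝ, A.Reaches l v ∧ ψ.Holds v

/-- The maximal absolute value of an integer constant in the invariants and guards of `A`. -/
def maxConst [Fintype Loc] : ℕ :=
  max (Finset.univ.sup fun l => (A.inv l).maxConst) (A.trans.sup fun τ => τ.guard.maxConst)

/-- An explicit bound on the clock values that have to be considered. With `K` the largest
absolute value of a constant of `A` and of the query `ψ`, it is
`|Loc| * (2K+2)^n * (4K+3)^(n^2) * (K+1)`. -/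
def clockBound [Fintype Loc] (ψ : ClockConstraint n) : ℕ :=
  let K := max A.maxConst ψ.maxConst
  Fintype.card Loc * (2 * K + 2) ^ n * (4 * K + 3) ^ (n ^ 2) * (K + 1)

end TimedAutomaton

/-! ### The BSR(BD) encoding of reachability -/

/-- The signature of the encoding: the locations are free-sort constant symbols, and the only
predicate symbol is `Reach`, of arity `1 + n` and sort `free × base × ⋯ × base`. -/
def taSig (Loc : Type) [Finite Loc] (n : ℕ) : Signature where
  Const := Loc
  Pred := Unit
  finite_const := inferInstance
  finite_pred := inferInstance
  arity _ := n + 1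
  sort _ := Fin.cons Srt.free (fun _ => Srt.base)

/-- The base-sort variable for the `i`-th clock `xᵢ`. -/
def preVar {n : ℕ} (i : Fin n) : ℕ := i

/-- The base-sort variable for the primed copy `xᵢ'` of the `i`-th clock. -/
def postVar {n : ℕ} (i : Fin n) : ℕ := n + i

/-- The atom `Reach(l, x̄)`, where the clocks are represented by the variables `x`. -/
def reachAtom {Loc : Type} [Finite Loc] {n : ℕ} (l : Loc) (x : Fin n → ℕ) :
    FreeAtom (taSig Loc n) :=
  .pred () (Fin.cons (α := fun i => FreeTerm Loc ((taSig Loc n).sort () i))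
    (FreeTerm.const l) (fun i => FreeTerm.bvar (x i)))

/-- The arithmetic atoms corresponding to an atomic clock constraint. -/
def ClockAtom.toBD {n : ℕ} (x : Fin n → ℕ) : ClockAtom n → List BDAtom
  | .tt => []
  | .cst i r c => [.cst (x i) r c]
  | .diff i j r c => [.diff (x i) (x j) r c]

/-- `ψ[x]`: the clock constraint `ψ` over the variables `x`. -/
def ClockConstraint.toBD {n : ℕ} (ψ : ClockConstraint n) (x : Fin n → ℕ) : List BDAtom :=
  ψ.flatMap (ClockAtom.toBD x)

/-- `0 ≤ x ∧ x < lam + 1` for every clock.  The redundant atom `x ≤ lam + 1` is there because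
BSR(BD) clauses need non-strict upper bounds. -/
def clockBounds {n : ℕ} (lam : ℕ) (x : Fin n → ℕ) : List BDAtom :=
  (List.finRange n).flatMap fun i =>
    [.cst (x i) .ge 0, .cst (x i) .lt ((lam : ℚ) + 1), .cst (x i) .le ((lam : ℚ) + 1)]

/-- A way of making true all the equivalences `xᵢ - xⱼ ≤ k ↔ xᵢ' - xⱼ' ≤ k` (first component) and
`xᵢ - xⱼ ≥ k ↔ xᵢ' - xⱼ' ≥ k` (second component), `-lam ≤ k ≤ lam`: for each of them, either both
sides are true or both sides are false.  The entry `m` stands for `k = m - lam`. -/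
abbrev DelayCase (n lam : ℕ) := Fin n → Fin n → Fin (2 * lam + 1) → Bool × Bool

/-- The difference constraints of a case: one disjunct of the disjunctive normal form of the
conjunction of the above equivalences. -/
def DelayCase.atoms {n lam : ℕ} (σ : DelayCase n lam) : List BDAtom :=
  (List.finRange n).flatMap fun i =>
  (List.finRange n).flatMap fun j =>
  (List.finRange (2 * lam + 1)).flatMap fun (m : Fin (2 * lam + 1)) =>
    let k : ℚ := ((m : ℕ) : ℚ) - (lam : ℚ)
    let rLe : LARel := if (σ i j m).1 then .le else .gt
    let rGe : LARel := if (σ i j m).2 then .ge else .lt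
    [.diff (preVar i) (preVar j) rLe k, .diff (postVar i) (postVar j) rLe k,
     .diff (preVar i) (preVar j) rGe k, .diff (postVar i) (postVar j) rGe k]

namespace TimedAutomaton

variable {Loc : Type} [Finite Loc] {n : ℕ} (A : TimedAutomaton Loc n)

/-- `⋀ x = 0 ∧ inv[x̄] ∧ bounds ‖ → Reach(l₀, x̄)`. -/
def initialClause (lam : ℕ) : BDClause (taSig Loc n) where
  arith := ((List.finRange n).map (fun i => BDAtom.cst (preVar i) .eq 0) ++
    (A.inv A.init).toBD preVar ++ clockBounds (n := n) lam preVar : List BDAtom)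
  ante := 0
  succ := {reachAtom A.init preVar}

/-- The part of the bounded delay clauses for the location `l` that belongs to the case `σ`:
`(differences) ∧ ⋀ x' ≥ x ∧ inv_l[x̄'] ∧ bounds ‖ Reach(l, x̄) → Reach(l, x̄')`. -/
def delayClause (lam : ℕ) (l : Loc) (σ : DelayCase n lam) : BDClause (taSig Loc n) where
  arith := (σ.atoms ++
    (List.finRange n).map (fun i => BDAtom.var (postVar i) .ge (preVar i)) ++
    (A.inv l).toBD postVar ++
    clockBounds (n := n) lam preVar ++ clockBounds (n := n) lam postVar : List BDAtom)
  ante := {reachAtom l preVar}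
  succ := {reachAtom l postVar}

/-- `g[x̄] ∧ ⋀_{x ∈ Z} x' = 0 ∧ ⋀_{x ∉ Z} x' = x ∧ inv[x̄'] ∧ bounds
‖ Reach(l, x̄) → Reach(l', x̄')`. -/
def transitionClause (lam : ℕ) (τ : TATransition Loc n) : BDClause (taSig Loc n) where
  arith := (τ.guard.toBD preVar ++
    (List.finRange n).map (fun i => if i ∈ τ.reset then BDAtom.cst (postVar i) .eq 0
      else BDAtom.var (postVar i) .eq (preVar i)) ++
    (A.inv τ.dst).toBD postVar ++
    clockBounds (n := n) lam preVar ++ clockBounds (n := n) lam postVar : List BDAtom)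
  ante := {reachAtom τ.src preVar}
  succ := {reachAtom τ.dst postVar}

/-- The BSR(BD) encoding of `A` with all clocks confined to `[0, lam + 1)`. -/
def bdEncoding (lam : ℕ) : Set (BDClause (taSig Loc n)) :=
  {A.initialClause lam} ∪
    Set.range (fun p : Loc × DelayCase n lam => A.delayClause lam p.1 p.2) ∪
    A.transitionClause lam '' (A.trans : Set (TATransition Loc n))

end TimedAutomaton

/-- The query clause `ψ[x̄] ∧ bounds ‖ Reach(l, x̄) → □`. -/
def queryClause {Loc : Type} [Finite Loc] {n : ℕ} (lam : ℕ) (l : Loc) (ψ : ClockConstraint n) :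
    BDClause (taSig Loc n) where
  arith := (ψ.toBD preVar ++ clockBounds (n := n) lam preVar : List BDAtom)
  ante := {reachAtom l preVar}
  succ := 0

/-! The clauses are Horn, so the encoding has a least model, in which `Reach` consists of the
derivable states `BoundedReach`. Every model contains these states, and the query clause forbids
exactly those that satisfy `ψ`. Unsatisfiability thus means that some derivable state satisfies `ψ`
(`not_satisfiable_iff`). It remains to compare derivable with reachable states, up to an equivalence
that preserves the clock constraints.

The equivalence `RegionEquiv K` records how clocks and clock differences compare with integers of
absolute value at most `K`. It is a bisimulation because the delays leading from `w` into a given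
region are cut out by bounds `k - w i`, and a finite system of bounds on one real number is solvable
once each lower bound is consistent with each upper bound. Such a consistency condition only
concerns a difference of two clocks (`exists_delay_regionEquiv`).

Soundness (`BoundedReach.exists_reaches`): a delay clause does not force all clocks to advance
equally. It preserves the integer comparisons of differences and decreases no clock, which is enough
to replace its effect by a genuine delay of an equivalent reachable state.

Completeness (`Reaches.exists_boundedReach`): a reachable region is reached in fewer steps than
there are region codes. Delays can be cut off at `K + 1`, so each step raises a clock by at most `K
+ 1`. The number of codes times `K + 1` is therefore a bound for the clocks, and it is the bound
imposed on `lam`. -/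

/-! ### Comparing reals with finitely many integers -/

/-- `x` and `y` compare in the same way with all the integers in `s`. -/
def SameCuts (s : Finset ℤ) (x y : ℝ) : Prop :=
  ∀ k ∈ s, (x ≤ k ↔ y ≤ k) ∧ (x < k ↔ y < k)

namespace SameCuts

variable {s : Finset ℤ} {x y z : ℝ}

theorem refl (s : Finset ℤ) (x : ℝ) : SameCuts s x x := fun _ _ => ⟨Iff.rfl, Iff.rfl⟩

theorem symm (h : SameCuts s x y) : SameCuts s y x :=
  fun k hk => ⟨(h k hk).1.symm, (h k hk).2.symm⟩

theorem trans (h : SameCuts s x y) (h' : SameCuts s y z) : SameCuts s x z :=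
  fun k hk => ⟨(h k hk).1.trans (h' k hk).1, (h k hk).2.trans (h' k hk).2⟩

theorem neg (hs : ∀ k ∈ s, -k ∈ s) (h : SameCuts s x y) : SameCuts s (-x) (-y) := by
  intro k hk
  have := h (-k) (hs k hk)
  push_cast at this
  refine ⟨?_, ?_⟩
  · rw [neg_le, neg_le (a := y), ← not_lt, ← not_lt, this.2]
  · rw [neg_lt, neg_lt (a := y), ← not_le, ← not_le, this.1]

theorem holds_iff (h : SameCuts s x y) (r : LARel) {c : ℤ} (hc : c ∈ s) :
    r.Holds x c ↔ r.Holds y c := by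
  obtain ⟨h1, h2⟩ := h c hc
  have h3 : (c : ℝ) ≤ x ↔ (c : ℝ) ≤ y := by rw [← not_lt, h2, not_lt]
  cases r <;> simp only [LARel.Holds, ge_iff_le, gt_iff_lt, ne_eq]
  · exact h2
  · exact h1
  · rw [le_antisymm_iff, le_antisymm_iff, h1, h3]
  · rw [le_antisymm_iff, le_antisymm_iff, h1, h3]
  · exact h3
  · rw [← not_le, h1, not_le]

end SameCuts

open Classical in
/-- The number of integers in `s` that are at most `x` plus the number of those less than `x`. -/
noncomputable def cutCode (s : Finset ℤ) (x : ℝ) : ℕ :=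
  (s.filter fun k : ℤ => (k : ℝ) ≤ x).card + (s.filter fun k : ℤ => (k : ℝ) < x).card

theorem cutCode_le (s : Finset ℤ) (x : ℝ) : cutCode s x ≤ 2 * s.card := by
  rw [two_mul]
  exact add_le_add (Finset.card_filter_le _ _) (Finset.card_filter_le _ _)

/-- Excluding the code `0` saves one value: clocks need `2 * K + 2` codes, one less than
`cutCode_le` alone would give. -/
theorem one_le_cutCode {s : Finset ℤ} (hs : (0 : ℤ) ∈ s) {x : ℝ} (hx : 0 ≤ x) :
    1 ≤ cutCode s x := by
  classical
  have : 0 < (s.filter fun k : ℤ => (k : ℝ) ≤ x).card :=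
    Finset.card_pos.2 ⟨0, by simp [hs, hx]⟩
  unfold cutCode
  convert Nat.le_add_right_of_le this using 1

theorem cutCode_congr {s : Finset ℤ} {x y : ℝ} (h : SameCuts s x y) :
    cutCode s x = cutCode s y := by
  unfold cutCode
  congr 2
  · refine Finset.filter_congr fun k hk => ?_
    rw [← not_lt, (h k hk).2, not_lt]
  · refine Finset.filter_congr fun k hk => ?_
    rw [← not_le, (h k hk).1, not_le]

/-- Both counted sets grow with `x`. Equal sums therefore force both cardinalities to agree, and
nested finite sets of equal cardinality coincide. -/
theorem sameCuts_of_cutCode_eq {s : Finset ℤ} {x y : ℝ} (h : cutCode s x = cutCode s y) :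
    SameCuts s x y := by
  classical
  wlog hxy : x ≤ y generalizing x y
  · exact (this h.symm (le_of_not_ge hxy)).symm
  have s1 : (s.filter fun k : ℤ => (k : ℝ) ≤ x) ⊆ (s.filter fun k : ℤ => (k : ℝ) ≤ y) :=
    Finset.monotone_filter_right s fun k _ (hk : (k : ℝ) ≤ x) => hk.trans hxy
  have s2 : (s.filter fun k : ℤ => (k : ℝ) < x) ⊆ (s.filter fun k : ℤ => (k : ℝ) < y) :=
    Finset.monotone_filter_right s fun k _ (hk : (k : ℝ) < x) => hk.trans_le hxy
  have c1 := Finset.card_le_card s1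
  have c2 := Finset.card_le_card s2
  have h' : (s.filter fun k : ℤ => (k : ℝ) ≤ x).card + (s.filter fun k : ℤ => (k : ℝ) < x).card =
      (s.filter fun k : ℤ => (k : ℝ) ≤ y).card + (s.filter fun k : ℤ => (k : ℝ) < y).card := by
    unfold cutCode at h
    convert h
  have e1 := Finset.eq_of_subset_of_card_le s1 (by omega)
  have e2 := Finset.eq_of_subset_of_card_le s2 (by omega)
  intro k hk
  have m1 := Finset.ext_iff.1 e1 k
  have m2 := Finset.ext_iff.1 e2 k
  simp only [Finset.mem_filter, hk, true_and] at m1 m2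
  exact ⟨by rw [← not_lt, m2, not_lt], by rw [← not_le, m1, not_le]⟩

/-! ### Region equivalence -/

/-- Two clock valuations agree on all the comparisons of clocks with integers in `[0, K]` and of
clock differences with integers in `[-K, K]`. -/
structure RegionEquiv {n : ℕ} (K : ℕ) (v w : Fin n → ℝ) : Prop where
  clock : ∀ i, SameCuts (Finset.Icc 0 (K : ℤ)) (v i) (w i)
  diff : ∀ i j, SameCuts (Finset.Icc (-(K : ℤ)) K) (v i - v j) (w i - w j)

namespace RegionEquiv

variable {n K : ℕ} {u v w : Fin n → ℝ}

theorem refl (K : ℕ) (v : Fin n → ℝ) : RegionEquiv K v v :=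
  ⟨fun _ => .refl _ _, fun _ _ => .refl _ _⟩

theorem symm (h : RegionEquiv K v w) : RegionEquiv K w v :=
  ⟨fun i => (h.clock i).symm, fun i j => (h.diff i j).symm⟩

theorem trans (h : RegionEquiv K u v) (h' : RegionEquiv K v w) : RegionEquiv K u w :=
  ⟨fun i => (h.clock i).trans (h'.clock i), fun i j => (h.diff i j).trans (h'.diff i j)⟩

/-- Comparisons of nonnegative clocks with integers in `[-K, K]` are also determined. -/
theorem clock_symm (h : RegionEquiv K v w) (hv : ∀ i, 0 ≤ v i) (hw : ∀ i, 0 ≤ w i) (i : Fin n) :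
    SameCuts (Finset.Icc (-(K : ℤ)) K) (v i) (w i) := by
  intro k hk
  rw [Finset.mem_Icc] at hk
  rcases le_or_gt 0 k with h0 | h0
  · exact h.clock i k (Finset.mem_Icc.2 ⟨h0, hk.2⟩)
  · have h0' : (k : ℝ) < 0 := by exact_mod_cast h0
    have := hv i
    have := hw i
    exact ⟨iff_of_false (by linarith) (by linarith), iff_of_false (by linarith) (by linarith)⟩

/-- Resetting one of two clocks turns their difference into plus or minus the other clock, which
must then be compared with negative integers too. Nonnegativity settles those comparisons. -/
theorem reset (h : RegionEquiv K v w) (hv : ∀ i, 0 ≤ v i) (hw : ∀ i, 0 ≤ w i)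
    (Z : Finset (Fin n)) :
    RegionEquiv K (fun i => if i ∈ Z then 0 else v i) (fun i => if i ∈ Z then 0 else w i) := by
  have hneg : ∀ k ∈ Finset.Icc (-(K : ℤ)) K, -k ∈ Finset.Icc (-(K : ℤ)) K := by
    intro k hk
    rw [Finset.mem_Icc] at hk ⊢
    omega
  refine ⟨fun i => ?_, fun i j => ?_⟩
  · split_ifs
    · exact .refl _ _
    · exact h.clock i
  · split_ifs
    · exact .refl _ _
    · simpa using (h.clock_symm hv hw j).neg hneg
    · simpa using h.clock_symm hv hw i
    · exact h.diff i j

end RegionEquiv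

theorem ClockAtom.holds_iff_of_regionEquiv {n K : ℕ} {v w : Fin n → ℝ} (h : RegionEquiv K v w)
    (hv : ∀ i, 0 ≤ v i) (hw : ∀ i, 0 ≤ w i) {a : ClockAtom n} (ha : a.absConst ≤ K) :
    a.Holds v ↔ a.Holds w := by
  cases a with
  | tt => exact Iff.rfl
  | cst x r c =>
    exact (h.clock_symm hv hw x).holds_iff r (by
      simp only [ClockAtom.absConst] at ha; rw [Finset.mem_Icc]; omega)
  | diff x y r c =>
    exact (h.diff x y).holds_iff r (by
      simp only [ClockAtom.absConst] at ha; rw [Finset.mem_Icc]; omega)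

theorem ClockConstraint.absConst_le_maxConst {n : ℕ} {ψ : ClockConstraint n} {a : ClockAtom n}
    (ha : a ∈ ψ) : a.absConst ≤ ψ.maxConst := by
  induction ψ with
  | nil => simp at ha
  | cons b ψ ih =>
    simp only [ClockConstraint.maxConst, List.map_cons, List.foldr_cons] at ih ⊢
    rcases List.mem_cons.1 ha with rfl | ha
    · exact le_max_left _ _
    · exact (ih ha).trans (le_max_right _ _)

theorem ClockConstraint.holds_iff_of_regionEquiv {n K : ℕ} {v w : Fin n → ℝ}
    (h : RegionEquiv K v w) (hv : ∀ i, 0 ≤ v i) (hw : ∀ i, 0 ≤ w i) {ψ : ClockConstraint n}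
    (hψ : ψ.maxConst ≤ K) : ψ.Holds v ↔ ψ.Holds w :=
  forall₂_congr fun _ ha =>
    ClockAtom.holds_iff_of_regionEquiv h hv hw ((absConst_le_maxConst ha).trans hψ)

/-! ### Simulating delays -/

/-- Finitely many lower and upper bounds, some of them strict, have a common solution if they are
pairwise consistent. -/
theorem exists_between_finsets (L L' U U' : Finset ℝ) (hL : L.Nonempty)
    (h1 : ∀ a ∈ L, ∀ b ∈ U, a ≤ b) (h2 : ∀ a ∈ L, ∀ b ∈ U', a < b)
    (h3 : ∀ a ∈ L', ∀ b ∈ U, a < b) (h4 : ∀ a ∈ L', ∀ b ∈ U', a < b) :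
    ∃ t, (∀ a ∈ L, a ≤ t) ∧ (∀ a ∈ L', a < t) ∧ (∀ b ∈ U, t ≤ b) ∧ (∀ b ∈ U', t < b) := by
  have hne : (L ∪ L').Nonempty := hL.mono Finset.subset_union_left
  have hmem := Finset.max'_mem _ hne
  have hmax := fun a ha => Finset.le_max' (L ∪ L') a ha
  set a₀ := (L ∪ L').max' hne
  by_cases hU : (U ∪ U').Nonempty
  · have hmem' := Finset.min'_mem _ hU
    have hmin := fun a ha => Finset.min'_le (U ∪ U') a ha
    set b₀ := (U ∪ U').min' hU
    simp only [Finset.mem_union] at hmem hmem' hmax hmin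
    have hab : a₀ ≤ b₀ := by
      rcases hmem with h | h <;> rcases hmem' with h' | h'
      · exact h1 _ h _ h'
      · exact (h2 _ h _ h').le
      · exact (h3 _ h _ h').le
      · exact (h4 _ h _ h').le
    -- The midpoint also meets the strict bounds: a strict lower bound lies below `b₀` whichever set
    -- `b₀` comes from, and symmetrically for strict upper bounds and `a₀`.
    refine ⟨(a₀ + b₀) / 2, fun a ha => ?_, fun a ha => ?_, fun b hb => ?_, fun b hb => ?_⟩
    · linarith [hmax a (.inl ha)]
    · have : a < b₀ := hmem'.elim (h3 a ha _) (h4 a ha _)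
      linarith [hmax a (.inr ha)]
    · linarith [hmin b (.inl hb)]
    · have : a₀ < b := hmem.elim (fun h => h2 _ h b hb) (fun h => h4 _ h b hb)
      linarith [hmin b (.inr hb)]
  · rw [Finset.not_nonempty_iff_eq_empty, Finset.union_eq_empty] at hU
    refine ⟨a₀ + 1, fun a ha => ?_, fun a ha => ?_, by simp [hU.1], by simp [hU.2]⟩
    · linarith [hmax a (Finset.mem_union_left _ ha)]
    · linarith [hmax a (Finset.mem_union_right _ ha)]

/-- If the clock differences of `w` are those of `u` up to region equivalence and no clock of `w`
has passed an integer that the same clock of `u` has not passed, then `w` can be delayed into the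
region of `u`. -/
theorem exists_delay_regionEquiv {n K : ℕ} {u w : Fin n → ℝ}
    (hdiff : ∀ i j, SameCuts (Finset.Icc (-(K : ℤ)) K) (u i - u j) (w i - w j))
    (hle : ∀ i, ∀ k ∈ Finset.Icc 0 (K : ℤ), (u i ≤ k → w i ≤ k) ∧ (u i < k → w i < k)) :
    ∃ t : ℝ, 0 ≤ t ∧ RegionEquiv K u (fun i => w i + t) := by
  classical
  let I : Finset (Fin n × ℤ) := Finset.univ ×ˢ Finset.Icc 0 (K : ℤ)
  let f : Fin n × ℤ → ℝ := fun p => p.2 - w p.1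
  have key : ∀ p ∈ I, ∀ q ∈ I, ((q.2 - p.2 : ℤ) : ℤ) ∈ Finset.Icc (-(K : ℤ)) K := by
    intro p hp q hq
    simp only [I, Finset.mem_product, Finset.mem_univ, true_and, Finset.mem_Icc] at hp hq ⊢
    omega
  have hI : ∀ p ∈ I, p.2 ∈ Finset.Icc 0 (K : ℤ) := fun p hp => (Finset.mem_product.1 hp).2
  -- Each comparison of `u i` with `k` becomes a bound `k - w i` on `t`; the inserted `0` encodes `0
  -- ≤ t`. Consistency with `0` is `hle`. For two clocks it compares a difference of `w` with a
  -- difference of integers in `[-K, K]`, which `hdiff` transfers from `u`.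
  obtain ⟨t, ht1, ht2, ht3, ht4⟩ := exists_between_finsets
    (insert 0 ((I.filter fun p => (p.2 : ℝ) ≤ u p.1).image f))
    ((I.filter fun p => (p.2 : ℝ) < u p.1).image f)
    ((I.filter fun p => u p.1 ≤ (p.2 : ℝ)).image f)
    ((I.filter fun p => u p.1 < (p.2 : ℝ)).image f)
    (Finset.insert_nonempty _ _) (by
      intro a ha b hb
      simp only [Finset.mem_insert, Finset.mem_image, Finset.mem_filter] at ha hb
      obtain ⟨q, ⟨hq, hqu⟩, rfl⟩ := hb
      rcases ha with rfl | ⟨p, ⟨hp, hpu⟩, rfl⟩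
      · have := (hle q.1 q.2 (hI q hq)).1 hqu
        simp only [f]; linarith
      · have := ((hdiff q.1 p.1 _ (key p hp q hq)).1).1 (by push_cast; linarith)
        push_cast at this
        simp only [f]; linarith) (by
      intro a ha b hb
      simp only [Finset.mem_insert, Finset.mem_image, Finset.mem_filter] at ha hb
      obtain ⟨q, ⟨hq, hqu⟩, rfl⟩ := hb
      rcases ha with rfl | ⟨p, ⟨hp, hpu⟩, rfl⟩
      · have := (hle q.1 q.2 (hI q hq)).2 hqu
        simp only [f]; linarith
      · have := ((hdiff q.1 p.1 _ (key p hp q hq)).2).1 (by push_cast; linarith)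
        push_cast at this
        simp only [f]; linarith) (by
      intro a ha b hb
      simp only [Finset.mem_image, Finset.mem_filter] at ha hb
      obtain ⟨q, ⟨hq, hqu⟩, rfl⟩ := hb
      obtain ⟨p, ⟨hp, hpu⟩, rfl⟩ := ha
      have := ((hdiff q.1 p.1 _ (key p hp q hq)).2).1 (by push_cast; linarith)
      push_cast at this
      simp only [f]; linarith) (by
      intro a ha b hb
      simp only [Finset.mem_image, Finset.mem_filter] at ha hb
      obtain ⟨q, ⟨hq, hqu⟩, rfl⟩ := hb
      obtain ⟨p, ⟨hp, hpu⟩, rfl⟩ := ha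
      have := ((hdiff q.1 p.1 _ (key p hp q hq)).2).1 (by push_cast; linarith)
      push_cast at this
      simp only [f]; linarith)
  simp only [Finset.forall_mem_insert, Finset.forall_mem_image, Finset.mem_filter, f]
    at ht1 ht2 ht3 ht4
  refine ⟨t, ht1.1, fun i k hk => ?_, fun i j => by simpa using hdiff i j⟩
  have hik : (i, k) ∈ I := by simpa [I] using hk
  refine ⟨⟨fun h => ?_, fun h => ?_⟩, ⟨fun h => ?_, fun h => ?_⟩⟩
  · have := ht3 ⟨hik, h⟩
    dsimp only at this
    linarith
  · by_contra hlt
    have := ht2 ⟨hik, not_le.1 hlt⟩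
    dsimp only at this
    linarith
  · have := ht4 ⟨hik, h⟩
    dsimp only at this
    linarith
  · by_contra hlt
    have := ht1.2 ⟨hik, not_lt.1 hlt⟩
    dsimp only at this
    linarith

/-- A delay can be cut off at `K + 1` without changing the region that it leads to. -/
theorem regionEquiv_min_delay {n K : ℕ} {w : Fin n → ℝ} (hw : ∀ i, 0 ≤ w i) (t : ℝ) :
    RegionEquiv K (fun i => w i + t) (fun i => w i + min t (K + 1)) := by
  refine ⟨fun i k hk => ?_, fun i j => by simpa using .refl _ _⟩
  rcases le_total t (K + 1) with h | h
  · simp [min_eq_left h]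
  -- Both delays now push every clock beyond `K`, so all the comparisons fail on both sides.
  · have hkK : (k : ℝ) ≤ K := by exact_mod_cast (Finset.mem_Icc.1 hk).2
    have := hw i
    simp only [min_eq_right h]
    exact ⟨iff_of_false (by linarith) (by linarith), iff_of_false (by linarith) (by linarith)⟩

/-! ### Region equivalence is a bisimulation -/

namespace TimedAutomaton

variable {Loc : Type} {n : ℕ} {A : TimedAutomaton Loc n}

theorem Step.nonneg {s s' : Loc × (Fin n → ℝ)} (h : A.Step s s') (hs : ∀ i, 0 ≤ s.2 i) (i : Fin n) :
    0 ≤ s'.2 i := by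
  cases h with
  | delay l v t ht hinv => exact add_nonneg (hs i) ht
  | location τ hτ v hguard hinv =>
    dsimp only
    split_ifs
    · exact le_rfl
    · exact hs i

theorem inv_maxConst_le [Fintype Loc] (A : TimedAutomaton Loc n) (l : Loc) :
    (A.inv l).maxConst ≤ A.maxConst :=
  (Finset.le_sup (f := fun l => (A.inv l).maxConst) (Finset.mem_univ l)).trans (le_max_left _ _)

theorem guard_maxConst_le [Fintype Loc] {τ : TATransition Loc n} (hτ : τ ∈ A.trans) :
    τ.guard.maxConst ≤ A.maxConst :=
  (Finset.le_sup (f := fun τ : TATransition Loc n => τ.guard.maxConst) hτ).trans (le_max_right _ _)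

/-- A step can be simulated from an equivalent state, with a delay of at most `K + 1`. -/
theorem Step.exists_regionEquiv [Fintype Loc] {K : ℕ} (hK : A.maxConst ≤ K)
    {s s' : Loc × (Fin n → ℝ)} (h : A.Step s s') (hs : ∀ i, 0 ≤ s.2 i)
    {w : Fin n → ℝ} (hw : ∀ i, 0 ≤ w i) (he : RegionEquiv K s.2 w) :
    ∃ w', A.Step (s.1, w) (s'.1, w') ∧ RegionEquiv K s'.2 w' ∧ ∀ i, w' i ≤ w i + (K + 1) := by
  cases h with
  | delay l v t ht hinv =>
    dsimp only at *
    obtain ⟨t', ht', he'⟩ := exists_delay_regionEquiv (K := K) (u := fun i => v i + t) (w := w)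
      (fun i j => by simpa using he.diff i j)
      (fun i k hk => ⟨fun h => ((he.clock i k hk).1).1 (by linarith),
        fun h => ((he.clock i k hk).2).1 (by linarith)⟩)
    have he'' := he'.trans (regionEquiv_min_delay hw t')
    have hpos : 0 ≤ min t' ((K : ℝ) + 1) := le_min ht' (by positivity)
    refine ⟨_, .delay l w _ hpos ?_, he'', fun i => ?_⟩
    · exact (ClockConstraint.holds_iff_of_regionEquiv he'' (fun i => add_nonneg (hs i) ht)
        (fun i => add_nonneg (hw i) hpos) ((A.inv_maxConst_le l).trans hK)).1 hinv
    · have := min_le_right t' ((K : ℝ) + 1)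
      linarith
  | location τ hτ v hguard hinv =>
    dsimp only at *
    have he' := he.reset hs hw τ.reset
    refine ⟨_, .location τ hτ w ?_ ?_, he', fun i => ?_⟩
    · exact (ClockConstraint.holds_iff_of_regionEquiv he hs hw
        ((guard_maxConst_le hτ).trans hK)).1 hguard
    · refine (ClockConstraint.holds_iff_of_regionEquiv he' (fun i => ?_) (fun i => ?_)
        ((A.inv_maxConst_le _).trans hK)).1 hinv
      · split_ifs
        exacts [le_rfl, hs i]
      · split_ifs
        exacts [le_rfl, hw i]
    · have := hw i
      split_ifs <;> linarith

end TimedAutomaton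

/-! ### Counting regions -/

/-- The region of a state, encoded in a finite type. -/
noncomputable def regionCode {Loc : Type} {n : ℕ} (K : ℕ) (s : Loc × (Fin n → ℝ)) :
    Loc × (Fin n → Fin (2 * K + 2)) × (Fin n → Fin n → Fin (4 * K + 3)) :=
  (s.1, fun i => Fin.ofNat _ (cutCode (Finset.Icc 0 (K : ℤ)) (s.2 i) - 1),
    fun i j => Fin.ofNat _ (cutCode (Finset.Icc (-(K : ℤ)) K) (s.2 i - s.2 j)))

theorem regionCode_congr {Loc : Type} {n K : ℕ} (l : Loc) {v w : Fin n → ℝ}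
    (h : RegionEquiv K v w) : regionCode K (l, v) = regionCode K (l, w) := by
  simp only [regionCode, cutCode_congr (h.clock _), cutCode_congr (h.diff _ _)]

/-- Nonnegativity is essential: the truncated `- 1` in `regionCode` would otherwise merge the codes
`0` and `1`. The cardinality bounds ensure that `Fin.ofNat` does not wrap around. -/
theorem regionEquiv_of_regionCode_eq {Loc : Type} {n K : ℕ} {s s' : Loc × (Fin n → ℝ)}
    (hs : ∀ i, 0 ≤ s.2 i) (hs' : ∀ i, 0 ≤ s'.2 i) (h : regionCode K s = regionCode K s') :
    s.1 = s'.1 ∧ RegionEquiv K s.2 s'.2 := by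
  simp only [regionCode, Prod.mk.injEq, funext_iff, Fin.ext_iff, Fin.val_ofNat] at h
  refine ⟨h.1, fun i => sameCuts_of_cutCode_eq ?_, fun i j => sameCuts_of_cutCode_eq ?_⟩
  · have h0 : (0 : ℤ) ∈ Finset.Icc 0 (K : ℤ) := by simp
    have h1 := one_le_cutCode h0 (hs i)
    have h2 := one_le_cutCode h0 (hs' i)
    have h3 := cutCode_le (Finset.Icc 0 (K : ℤ)) (s.2 i)
    have h4 := cutCode_le (Finset.Icc 0 (K : ℤ)) (s'.2 i)
    have hc : (Finset.Icc 0 (K : ℤ)).card = K + 1 := by rw [Int.card_Icc]; omega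
    rw [hc] at h3 h4
    have := h.2.1 i
    rw [Nat.mod_eq_of_lt (by omega), Nat.mod_eq_of_lt (by omega)] at this
    omega
  · have h3 := cutCode_le (Finset.Icc (-(K : ℤ)) K) (s.2 i - s.2 j)
    have h4 := cutCode_le (Finset.Icc (-(K : ℤ)) K) (s'.2 i - s'.2 j)
    have hc : (Finset.Icc (-(K : ℤ)) K).card = 2 * K + 1 := by rw [Int.card_Icc]; omega
    rw [hc] at h3 h4
    have := h.2.2 i j
    rwa [Nat.mod_eq_of_lt (by omega), Nat.mod_eq_of_lt (by omega)] at this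

/-- In a finite type, reachability is witnessed by a path shorter than the number of elements. -/
theorem Relation.ReflTransGen.exists_path_lt_card {α : Type*} [Fintype α] {r : α → α → Prop}
    {a b : α} (h : Relation.ReflTransGen r a b) :
    ∃ m < Fintype.card α, ∃ p : ℕ → α, p 0 = a ∧ p m = b ∧ ∀ i < m, r (p i) (p (i + 1)) := by
  classical
  have hex : ∃ m, ∃ p : ℕ → α, p 0 = a ∧ p m = b ∧ ∀ i < m, r (p i) (p (i + 1)) := by
    induction h with
    | refl => exact ⟨0, fun _ => a, rfl, rfl, by simp⟩
    | @tail b c _ hbc ih =>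
      obtain ⟨m, p, h0, hm, hp⟩ := ih
      refine ⟨m + 1, fun i => if i ≤ m then p i else c, by simp [h0], by simp, fun i hi => ?_⟩
      rcases Nat.lt_succ_iff_lt_or_eq.1 hi with hi | rfl
      · simpa [hi.le, Nat.succ_le_of_lt hi] using hp i hi
      · simpa [hm] using hbc
  refine ⟨Nat.find hex, ?_, Nat.find_spec hex⟩
  obtain ⟨p, h0, hm, hp⟩ := Nat.find_spec hex
  have hmin := fun m hm => Nat.find_min (m := m) hex hm
  generalize Nat.find hex = m at *
  by_contra! hcard
  -- A path of minimal length with too many vertices repeats one; cutting out the loop between the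
  -- two visits contradicts minimality.
  obtain ⟨i, j, hne, hij⟩ := Fintype.exists_ne_map_eq_of_card_lt
    (fun i : Fin (m + 1) => p i) (by simpa using Nat.lt_succ_of_le hcard)
  wlog hlt : i < j generalizing i j
  · exact this j i hne.symm hij.symm (lt_of_le_of_ne (not_lt.1 hlt) hne.symm)
  obtain ⟨i, hi⟩ := i
  obtain ⟨j, hj⟩ := j
  simp only [Fin.mk_lt_mk] at hlt hij
  refine hmin (m - (j - i)) (by omega)
    ⟨fun k => if k ≤ i then p k else p (k + (j - i)), by simp [h0], ?_, fun k hk => ?_⟩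
  · dsimp only
    split_ifs with hle
    -- The shortened path ends at or before index `i` only if the loop reached the end of the
    -- original path.
    · have hmj : m = j := by omega
      rw [← hm, hmj, ← hij]
      congr 1
      omega
    · rw [← hm]
      congr 1
      omega
  · dsimp only
    rcases lt_trichotomy k i with hki | rfl | hki
    · rw [if_pos hki.le, if_pos (Nat.succ_le_of_lt hki)]
      exact hp k (by omega)
    · rw [if_pos le_rfl, if_neg (by omega), hij]
      convert hp j (by omega) using 2
      omega
    · rw [if_neg (by omega), if_neg (by omega)]
      convert hp (k + (j - i)) (by omega) using 2
      omega

/-! ### The least model of the encoding -/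

/-- All clocks lie in `[0, lam + 1)`. -/
def InClockRange {n : ℕ} (lam : ℕ) (v : Fin n → ℝ) : Prop :=
  ∀ i, 0 ≤ v i ∧ v i < lam + 1

namespace TimedAutomaton

variable {Loc : Type} {n : ℕ} (A : TimedAutomaton Loc n)

/-- The states derivable with the clauses of the encoding. -/
inductive BoundedReach (lam : ℕ) : Loc → (Fin n → ℝ) → Prop
  | init (hinv : (A.inv A.init).Holds (fun _ => 0)) : BoundedReach lam A.init (fun _ => 0)
  | delay (l : Loc) (v v' : Fin n → ℝ) (h : BoundedReach lam l v)
      (hv : InClockRange lam v) (hv' : InClockRange lam v')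
      (hdiff : ∀ i j, SameCuts (Finset.Icc (-(lam : ℤ)) lam) (v i - v j) (v' i - v' j))
      (hle : ∀ i, v i ≤ v' i) (hinv : (A.inv l).Holds v') : BoundedReach lam l v'
  | location (τ : TATransition Loc n) (hτ : τ ∈ A.trans) (v : Fin n → ℝ)
      (h : BoundedReach lam τ.src v) (hv : InClockRange lam v) (hguard : τ.guard.Holds v)
      (hinv : (A.inv τ.dst).Holds (fun i => if i ∈ τ.reset then 0 else v i)) :
      BoundedReach lam τ.dst (fun i => if i ∈ τ.reset then 0 else v i)

variable {A}

theorem Reaches.nonneg {l : Loc} {v : Fin n → ℝ} (h : A.Reaches l v) (i : Fin n) : 0 ≤ v i := by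
  have : ∀ s, Relation.ReflTransGen A.Step (A.init, fun _ => 0) s → ∀ i, 0 ≤ s.2 i := by
    intro s hs
    induction hs with
    | refl => exact fun _ => le_rfl
    | tail _ hst ih => exact hst.nonneg ih
  exact this _ h.2 i

theorem BoundedReach.inClockRange {lam : ℕ} {l : Loc} {v : Fin n → ℝ}
    (h : A.BoundedReach lam l v) : InClockRange lam v := by
  have hpos : (0 : ℝ) < lam + 1 := by positivity
  cases h with
  | init => exact fun _ => ⟨le_rfl, hpos⟩
  | delay _ _ _ _ _ hv' => exact hv'
  | location τ hτ v h hv =>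
    intro i
    dsimp only
    split_ifs
    exacts [⟨le_rfl, hpos⟩, hv i]

/-- Two valuations in the clock range agree on all comparisons of clock differences with integers
if they do so for the integers in `[-lam, lam]`. -/
theorem sameCuts_diff_of_inClockRange {lam : ℕ} {v w : Fin n → ℝ} (hv : InClockRange lam v)
    (hw : InClockRange lam w) {i j : Fin n}
    (h : SameCuts (Finset.Icc (-(lam : ℤ)) lam) (v i - v j) (w i - w j)) (s : Finset ℤ) :
    SameCuts s (v i - v j) (w i - w j) := by
  intro k _
  have := hv i
  have := hv j
  have := hw i
  have := hw j
  by_cases hk : k ∈ Finset.Icc (-(lam : ℤ)) lam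
  · exact h k hk
  -- Both differences lie strictly between `-(lam + 1)` and `lam + 1`, so integers outside `[-lam,
  -- lam]` do not separate them.
  · rw [Finset.mem_Icc, not_and_or, not_le, not_le] at hk
    rcases hk with hk | hk
    · have : (k : ℝ) + 1 ≤ -(lam : ℝ) := by exact_mod_cast hk
      exact ⟨iff_of_false (by linarith) (by linarith), iff_of_false (by linarith) (by linarith)⟩
    · have : (lam : ℝ) + 1 ≤ k := by exact_mod_cast hk
      exact ⟨iff_of_true (by linarith) (by linarith), iff_of_true (by linarith) (by linarith)⟩

/-- The range bound is itself a comparison with the integer `lam + 1`, which is why soundness works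
with `RegionEquiv (lam + 1)`. -/
theorem InClockRange.of_regionEquiv {lam : ℕ} {v w : Fin n → ℝ} (hv : InClockRange lam v)
    (hw : ∀ i, 0 ≤ w i) (h : RegionEquiv (lam + 1) v w) : InClockRange lam w := by
  refine fun i => ⟨hw i, ?_⟩
  have := ((h.clock i (lam + 1) (by simp; positivity)).2).1 (by push_cast; exact (hv i).2)
  exact_mod_cast this

/-- The encoding is sound: a derivable state is equivalent to a reachable one. -/
theorem BoundedReach.exists_reaches [Fintype Loc] {lam : ℕ} (hlam : A.maxConst ≤ lam) {l : Loc}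
    {v : Fin n → ℝ} (h : A.BoundedReach lam l v) :
    ∃ w, A.Reaches l w ∧ RegionEquiv (lam + 1) v w := by
  have hK : A.maxConst ≤ lam + 1 := hlam.trans (Nat.le_succ _)
  induction h with
  | init hinv => exact ⟨_, ⟨hinv, .refl⟩, .refl _ _⟩
  | delay l v v' h hv hv' hdiff hle hinv ih =>
    obtain ⟨w, hw, he⟩ := ih
    have hw0 := InClockRange.of_regionEquiv hv hw.nonneg he
    -- The clause controls differences only on `[-lam, lam]`; the clock range extends this to
    -- `[-(lam + 1), lam + 1]`, so that it composes with the equivalence of `v` and `w`.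
    obtain ⟨t, ht, he'⟩ := exists_delay_regionEquiv (K := lam + 1) (u := v') (w := w)
      (fun i j => (sameCuts_diff_of_inClockRange hv hv' (hdiff i j) _).symm.trans (he.diff i j))
      (fun i k hk => ⟨fun h => (he.clock i k hk).1.1 ((hle i).trans h),
        fun h => (he.clock i k hk).2.1 ((hle i).trans_lt h)⟩)
    refine ⟨_, ⟨hw.1, hw.2.tail (.delay l w t ht ?_)⟩, he'⟩
    exact (ClockConstraint.holds_iff_of_regionEquiv he' (fun i => (hv' i).1)
      (fun i => add_nonneg (hw.nonneg i) ht) ((A.inv_maxConst_le l).trans hK)).1 hinv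
  | location τ hτ v h hv hguard hinv ih =>
    obtain ⟨w, hw, he⟩ := ih
    obtain ⟨w', hstep, he', -⟩ := (Step.location τ hτ v hguard hinv).exists_regionEquiv hK
      (fun i => (hv i).1) hw.nonneg he
    exact ⟨w', ⟨hw.1, hw.2.tail hstep⟩, he'⟩

/-- A genuine delay leaves all clock differences unchanged, so within the clock range it is an
instance of a delay clause. -/
theorem Step.boundedReach {lam : ℕ} {s s' : Loc × (Fin n → ℝ)} (h : A.Step s s')
    (hs : A.BoundedReach lam s.1 s.2) (hs' : InClockRange lam s'.2) :
    A.BoundedReach lam s'.1 s'.2 := by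
  cases h with
  | delay l v t ht hinv =>
    exact .delay l v _ hs hs.inClockRange hs' (fun i j => by simpa using .refl _ _)
      (fun i => by linarith) hinv
  | location τ hτ v hguard hinv => exact .location τ hτ v hs hs.inClockRange hguard hinv

/-- The encoding is complete: up to equivalence, every reachable state is derivable. -/
theorem Reaches.exists_boundedReach [Fintype Loc] {K lam : ℕ} (hK : A.maxConst ≤ K)
    (hlam : Fintype.card Loc * (2 * K + 2) ^ n * (4 * K + 3) ^ (n ^ 2) * (K + 1) ≤ lam)
    {l : Loc} {v : Fin n → ℝ} (h : A.Reaches l v) :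
    ∃ w, A.BoundedReach lam l w ∧ RegionEquiv K v w := by
  -- The graph of region codes: an edge is witnessed by any step from a nonnegative state, so
  -- consecutive edges of a path need not share a concrete state.
  let Q : Loc × (Fin n → Fin (2 * K + 2)) × (Fin n → Fin n → Fin (4 * K + 3)) → _ → Prop :=
    fun c d => ∃ s s', (∀ i, 0 ≤ s.2 i) ∧ A.Step s s' ∧ regionCode K s = c ∧ regionCode K s' = d
  have hQ : ∀ s, Relation.ReflTransGen A.Step (A.init, fun _ => 0) s →
      (∀ i, 0 ≤ s.2 i) ∧
        Relation.ReflTransGen Q (regionCode K (A.init, fun _ => 0)) (regionCode K s) := by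
    intro s hs
    induction hs with
    | refl => exact ⟨fun _ => le_rfl, .refl⟩
    | tail _ hst ih => exact ⟨hst.nonneg ih.1, ih.2.tail ⟨_, _, ih.1, hst, rfl, rfl⟩⟩
  obtain ⟨m, hm, p, h0, hpm, hp⟩ := (hQ _ h.2).2.exists_path_lt_card
  have hcard : Fintype.card (Loc × (Fin n → Fin (2 * K + 2)) × (Fin n → Fin n → Fin (4 * K + 3))) =
      Fintype.card Loc * (2 * K + 2) ^ n * (4 * K + 3) ^ (n ^ 2) := by
    simp [Fintype.card_prod, ← pow_mul, sq, mul_assoc]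
  rw [hcard] at hm
  have hmlam : m * (K + 1) ≤ lam := (Nat.mul_le_mul_right _ hm.le).trans hlam
  -- The short path is realised by derivable states: the step witnessing each edge is simulated from
  -- the state already built, which adds at most `K + 1` to each clock.
  have main : ∀ i ≤ m, ∃ s : Loc × (Fin n → ℝ), A.BoundedReach lam s.1 s.2 ∧
      regionCode K s = p i ∧ ∀ x, s.2 x ≤ i * (K + 1) := by
    intro i
    induction i with
    | zero => exact fun _ => ⟨(A.init, fun _ => 0), .init h.1, h0.symm, fun x => by simp⟩
    | succ i ih =>
      intro hi
      obtain ⟨⟨l₁, w⟩, hw, hc, hb⟩ := ih (by omega)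
      obtain ⟨s, s', hs, hst, hs1, hs2⟩ := hp i (by omega)
      have hw0 : ∀ x, 0 ≤ w x := fun x => (hw.inClockRange x).1
      obtain ⟨hl, he⟩ := regionEquiv_of_regionCode_eq hs hw0 (hs1.trans hc.symm)
      obtain ⟨w', hst', he', hb'⟩ := hst.exists_regionEquiv hK hs hw0 he
      rw [hl] at hst'
      have hbound : ∀ x, w' x ≤ ((i + 1 : ℕ) : ℝ) * (K + 1) := fun x => by
        have := hb x
        have := hb' x
        push_cast
        dsimp only at *
        linarith
      have hi' : ((i + 1 : ℕ) : ℝ) * (K + 1) ≤ lam := by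
        exact_mod_cast (Nat.mul_le_mul_right _ hi).trans hmlam
      refine ⟨(s'.1, w'), hst'.boundedReach hw fun x => ⟨hst'.nonneg hw0 x, ?_⟩, ?_, hbound⟩
      · have := hbound x
        dsimp only
        linarith
      · rw [← hs2]
        exact (regionCode_congr _ he').symm
  obtain ⟨⟨l', w⟩, hw, hc, -⟩ := main m le_rfl
  obtain ⟨hl, he⟩ := regionEquiv_of_regionCode_eq (K := K) (s := (l', w)) (s' := (l, v))
    (fun x => (hw.inClockRange x).1) h.nonneg (hc.trans hpm)
  dsimp only at hl he hw
  subst hl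
  exact ⟨w, hw, he.symm⟩

end TimedAutomaton

/-! ### Semantics of the clauses -/

theorem mem_toBD_iff {n : ℕ} {ψ : ClockConstraint n} {x : Fin n → ℕ} (β : ℕ → ℝ) :
    (∀ a ∈ ψ.toBD x, a.Holds β) ↔ ψ.Holds (fun i => β (x i)) := by
  simp only [ClockConstraint.toBD, List.mem_flatMap, forall_exists_index, and_imp,
    ClockConstraint.Holds]
  rw [forall_comm]
  refine forall_congr' fun b => ?_
  rw [forall_comm]
  refine forall_congr' fun _ => ?_
  cases b <;> simp [ClockAtom.toBD, BDAtom.Holds, ClockAtom.Holds]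

theorem clockBounds_holds_iff {n lam : ℕ} {x : Fin n → ℕ} (β : ℕ → ℝ) :
    (∀ a ∈ clockBounds lam x, a.Holds β) ↔ InClockRange lam (fun i => β (x i)) := by
  simp only [clockBounds, List.mem_flatMap, List.mem_finRange, true_and, forall_exists_index,
    InClockRange]
  rw [forall_comm]
  refine forall_congr' fun i => ?_
  simp only [List.mem_cons, List.not_mem_nil, or_false, forall_eq_or_imp, forall_eq, BDAtom.Holds,
    LARel.Holds]
  push_cast
  exact ⟨fun h => ⟨h.1, h.2.1⟩, fun h => ⟨h.1, h.2, h.2.le⟩⟩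

/-- Each bit of `σ` is the common truth value of the two sides of one equivalence. -/
theorem DelayCase.atoms_holds_iff {n lam : ℕ} (σ : DelayCase n lam) (β : ℕ → ℝ) :
    (∀ a ∈ σ.atoms, a.Holds β) ↔ ∀ i j (m : Fin (2 * lam + 1)),
      (((σ i j m).1 = true ↔ β (preVar i) - β (preVar j) ≤ ((m : ℕ) : ℝ) - lam) ∧
        ((σ i j m).1 = true ↔ β (postVar i) - β (postVar j) ≤ ((m : ℕ) : ℝ) - lam)) ∧
      (((σ i j m).2 = true ↔ ((m : ℕ) : ℝ) - lam ≤ β (preVar i) - β (preVar j)) ∧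
        ((σ i j m).2 = true ↔ ((m : ℕ) : ℝ) - lam ≤ β (postVar i) - β (postVar j))) := by
  simp only [DelayCase.atoms, List.mem_flatMap, List.mem_finRange, true_and]
  constructor
  · intro h i j m
    have h' := fun a ha => h a ⟨i, j, m, ha⟩
    simp only [List.mem_cons, List.not_mem_nil, or_false, forall_eq_or_imp, forall_eq,
      BDAtom.Holds] at h'
    push_cast at h'
    rcases h1 : (σ i j m).1 <;> rcases h2 : (σ i j m).2 <;>
      simp only [h1, h2, LARel.Holds, reduceIte, Bool.false_eq_true, true_iff, false_iff, not_le,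
        gt_iff_lt, ge_iff_le] at h' ⊢ <;>
      tauto
  · rintro h a ⟨i, j, m, ha⟩
    have h' := h i j m
    revert a
    simp only [List.mem_cons, List.not_mem_nil, or_false, forall_eq_or_imp, forall_eq,
      BDAtom.Holds]
    push_cast
    rcases h1 : (σ i j m).1 <;> rcases h2 : (σ i j m).2 <;>
      simp only [h1, h2, LARel.Holds, reduceIte, Bool.false_eq_true, true_iff, false_iff, not_le,
        gt_iff_lt, ge_iff_le] at h' ⊢ <;>
      tauto

/-- Some case of the delay clauses applies to two valuations if and only if they agree on the
comparisons of clock differences with the integers in `[-lam, lam]`. -/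
theorem exists_delayCase_iff {n lam : ℕ} (β : ℕ → ℝ) :
    (∃ σ : DelayCase n lam, ∀ a ∈ σ.atoms, a.Holds β) ↔
      ∀ i j : Fin n, SameCuts (Finset.Icc (-(lam : ℤ)) lam)
        (β (preVar i) - β (preVar j)) (β (postVar i) - β (postVar j)) := by
  classical
  simp only [DelayCase.atoms_holds_iff]
  constructor
  · rintro ⟨σ, hσ⟩ i j k hk
    rw [Finset.mem_Icc] at hk
    obtain ⟨m, rfl⟩ : ∃ m : Fin (2 * lam + 1), k = ((m : ℕ) : ℤ) - lam :=
      ⟨⟨(k + lam).toNat, by omega⟩, by dsimp only; omega⟩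
    obtain ⟨⟨h1, h2⟩, h3, h4⟩ := hσ i j m
    push_cast
    exact ⟨h1.symm.trans h2, by rw [← not_le, ← not_le, ← h3, ← h4]⟩
  · intro h
    -- The case is read off the unprimed clocks; the primed ones agree by hypothesis.
    refine ⟨fun i j m => (decide (β (preVar i) - β (preVar j) ≤ ((m : ℕ) : ℝ) - lam),
      decide (((m : ℕ) : ℝ) - lam ≤ β (preVar i) - β (preVar j))), fun i j m => ?_⟩
    have := h i j (((m : ℕ) : ℤ) - lam) (by rw [Finset.mem_Icc]; omega)
    push_cast at this
    simp only [decide_eq_true_eq, true_and]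
    exact ⟨this.1, by rw [← not_lt, ← not_lt, this.2]⟩

/-- The argument tuple of an atom `Reach(l, v)`. -/
def reachTuple {Loc : Type} [Finite Loc] {n : ℕ} (I : Interp (taSig Loc n)) (l : I.Dom)
    (v : Fin n → ℝ) : (i : Fin (n + 1)) → ((taSig Loc n).sort () i).Carrier I.Dom :=
  Fin.cons (α := fun i => ((taSig Loc n).sort () i).Carrier I.Dom) l v

theorem freeAtom_reachAtom_iff {Loc : Type} [Finite Loc] {n : ℕ} (I : Interp (taSig Loc n))
    (βR : ℕ → ℝ) (βS : ℕ → I.Dom) (l : Loc) (x : Fin n → ℕ) :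
    I.freeAtom βR βS (reachAtom l x) ↔
      reachTuple I (I.const l) (fun i => βR (x i)) ∈ I.pred () := by
  have : (fun i => I.term βR βS
      ((Fin.cons (α := fun i => FreeTerm Loc ((taSig Loc n).sort () i))
        (FreeTerm.const l) (fun i => FreeTerm.bvar (x i)) :
        (i : Fin (n + 1)) → FreeTerm Loc ((taSig Loc n).sort () i)) i)) =
      reachTuple I (I.const l) (fun i => βR (x i)) := by
    funext i
    refine Fin.cases ?_ (fun i => ?_) i <;> rfl
  exact iff_of_eq (congrArg (· ∈ I.pred ()) this)

/-- The unprimed and primed variables occupy the disjoint index blocks `[0, n)` and `[n, 2n)`, so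
their values can be chosen independently. -/
theorem exists_assignment {n : ℕ} (v v' : Fin n → ℝ) :
    ∃ β : ℕ → ℝ, (∀ i : Fin n, β (preVar i) = v i) ∧ ∀ i : Fin n, β (postVar i) = v' i := by
  refine ⟨fun k => if h : k < n then v ⟨k, h⟩ else if h : k - n < n then v' ⟨k - n, h⟩ else 0,
    fun i => by simp [preVar], fun i => by simp [postVar]⟩

namespace TimedAutomaton

variable {Loc : Type} [Finite Loc] {n : ℕ} {A : TimedAutomaton Loc n}

/-- Every derivable state belongs to `Reach` in every model of the encoding. -/
theorem BoundedReach.mem_pred {lam : ℕ} {I : Interp (taSig Loc n)}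
    (hI : ∀ C ∈ A.bdEncoding lam, I.Models C) {l : Loc} {v : Fin n → ℝ}
    (h : A.BoundedReach lam l v) : reachTuple I (I.const l) v ∈ I.pred () := by
  -- The clauses contain no free-sort variables, so any constant assignment of that sort will do.
  obtain ⟨d⟩ := I.nonempty
  induction h with
  | init hinv =>
    obtain ⟨a, ha, h⟩ := hI (A.initialClause lam) (.inl (.inl rfl)) (fun _ => 0) (fun _ => d)
      (by
        simp only [initialClause, Multiset.mem_coe, List.mem_append, or_imp, forall_and]
        refine ⟨⟨?_, (mem_toBD_iff _).2 hinv⟩, (clockBounds_holds_iff _).2 fun i => ?_⟩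
        · simp [BDAtom.Holds, LARel.Holds]
        · exact ⟨le_rfl, by positivity⟩)
      (by simp [initialClause])
    rw [initialClause, Multiset.mem_singleton] at ha
    rwa [ha, freeAtom_reachAtom_iff] at h
  | delay l v v' h hv hv' hdiff hle hinv ih =>
    obtain ⟨β, h1, h2⟩ := exists_assignment v v'
    obtain rfl : (fun i => β (preVar i)) = v := funext h1
    obtain rfl : (fun i => β (postVar i)) = v' := funext h2
    obtain ⟨σ, hσ⟩ := (exists_delayCase_iff β).2 hdiff
    obtain ⟨a, ha, h⟩ := hI (A.delayClause lam l σ) (.inl (.inr ⟨(l, σ), rfl⟩)) β (fun _ => d)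
      (by
        simp only [delayClause, Multiset.mem_coe, List.mem_append, or_imp, forall_and]
        refine ⟨⟨⟨⟨hσ, ?_⟩, (mem_toBD_iff _).2 hinv⟩, (clockBounds_holds_iff _).2 hv⟩,
          (clockBounds_holds_iff _).2 hv'⟩
        simpa [BDAtom.Holds, LARel.Holds] using hle)
      (by
        simp only [delayClause, Multiset.mem_singleton, forall_eq]
        exact (freeAtom_reachAtom_iff ..).2 ih)
    rw [delayClause, Multiset.mem_singleton] at ha
    rwa [ha, freeAtom_reachAtom_iff] at h
  | location τ hτ v h hv hguard hinv ih =>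
    have hv' := (BoundedReach.location τ hτ v h hv hguard hinv).inClockRange
    obtain ⟨β, h1, h2⟩ := exists_assignment v fun i => if i ∈ τ.reset then 0 else v i
    obtain rfl : (fun i => β (preVar i)) = v := funext h1
    rw [← funext h2] at hinv hv' ⊢
    obtain ⟨a, ha, h⟩ := hI (A.transitionClause lam τ) (.inr ⟨τ, hτ, rfl⟩) β (fun _ => d)
      (by
        simp only [transitionClause, Multiset.mem_coe, List.mem_append, or_imp, forall_and]
        refine ⟨⟨⟨⟨(mem_toBD_iff _).2 hguard, ?_⟩, (mem_toBD_iff _).2 hinv⟩,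
          (clockBounds_holds_iff _).2 hv⟩, (clockBounds_holds_iff _).2 hv'⟩
        simp only [List.mem_map, List.mem_finRange, true_and, forall_exists_index,
          forall_apply_eq_imp_iff]
        intro i
        have := h2 i
        split_ifs at this ⊢ <;> simpa [BDAtom.Holds, LARel.Holds] using this)
      (by
        simp only [transitionClause, Multiset.mem_singleton, forall_eq]
        exact (freeAtom_reachAtom_iff ..).2 ih)
    rw [transitionClause, Multiset.mem_singleton] at ha
    rwa [ha, freeAtom_reachAtom_iff] at h

variable (A)

/-- The least model of the encoding. -/
def leastInterp (lam : ℕ) : Interp (taSig Loc n) where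
  Dom := Loc
  nonempty := ⟨A.init⟩
  const := id
  pred _ := {a | A.BoundedReach lam (a (0 : Fin (n + 1))) (fun i : Fin n => a i.succ)}

theorem freeAtom_leastInterp_iff (lam : ℕ) (βR : ℕ → ℝ) (βS : ℕ → Loc) (l : Loc)
    (x : Fin n → ℕ) : (A.leastInterp lam).freeAtom βR βS (reachAtom l x) ↔
      A.BoundedReach lam l (fun i => βR (x i)) :=
  freeAtom_reachAtom_iff (A.leastInterp lam) βR βS l x

theorem leastInterp_models (lam : ℕ) {C : BDClause (taSig Loc n)} (hC : C ∈ A.bdEncoding lam) :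
    (A.leastInterp lam).Models C := by
  intro βR βS har han
  rcases hC with (rfl | ⟨⟨l, σ⟩, rfl⟩) | ⟨τ, hτ, rfl⟩
  · refine ⟨_, Multiset.mem_singleton_self _, (A.freeAtom_leastInterp_iff ..).2 ?_⟩
    simp only [initialClause, Multiset.mem_coe, List.mem_append, or_imp, forall_and] at har
    obtain ⟨⟨h0, hinv⟩, -⟩ := har
    rw [mem_toBD_iff] at hinv
    have h0' : (fun i : Fin n => βR (preVar i)) = fun _ => 0 := by
      funext i
      simpa [BDAtom.Holds, LARel.Holds] using h0 _ (List.mem_map.2 ⟨i, List.mem_finRange i, rfl⟩)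
    rw [h0'] at hinv ⊢
    exact .init hinv
  · refine ⟨_, Multiset.mem_singleton_self _, (A.freeAtom_leastInterp_iff ..).2 ?_⟩
    have han' := (A.freeAtom_leastInterp_iff ..).1 (han _ (Multiset.mem_singleton_self _))
    simp only [delayClause, Multiset.mem_coe, List.mem_append, or_imp, forall_and] at har
    obtain ⟨⟨⟨⟨hσ, hle⟩, hinv⟩, hv⟩, hv'⟩ := har
    refine .delay l _ _ han' ((clockBounds_holds_iff _).1 hv) ((clockBounds_holds_iff _).1 hv')
      ((exists_delayCase_iff βR).1 ⟨σ, hσ⟩) (fun i => ?_) ((mem_toBD_iff _).1 hinv)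
    exact hle _ (List.mem_map.2 ⟨i, List.mem_finRange i, rfl⟩)
  · refine ⟨_, Multiset.mem_singleton_self _, (A.freeAtom_leastInterp_iff ..).2 ?_⟩
    have han' := (A.freeAtom_leastInterp_iff ..).1 (han _ (Multiset.mem_singleton_self _))
    simp only [transitionClause, Multiset.mem_coe, List.mem_append, or_imp, forall_and] at har
    obtain ⟨⟨⟨⟨hguard, hreset⟩, hinv⟩, hv⟩, -⟩ := har
    rw [mem_toBD_iff] at hinv
    have hpost : (fun i : Fin n => βR (postVar i)) =
        fun i => if i ∈ τ.reset then 0 else βR (preVar i) := by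
      funext i
      have := hreset _ (List.mem_map.2 ⟨i, List.mem_finRange i, rfl⟩)
      split_ifs at this ⊢ <;> simpa [BDAtom.Holds, LARel.Holds] using this
    rw [hpost] at hinv ⊢
    exact .location τ hτ _ han' ((clockBounds_holds_iff _).1 hv) ((mem_toBD_iff _).1 hguard) hinv

/-- The encoding with the query is unsatisfiable if and only if a state satisfying the query is
derivable. -/
theorem not_satisfiable_iff (lam : ℕ) (l : Loc) (ψ : ClockConstraint n) :
    ¬ ClauseSetSatisfiable (A.bdEncoding lam ∪ {queryClause lam l ψ}) ↔
      ∃ v, A.BoundedReach lam l v ∧ ψ.Holds v := by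
  constructor
  · intro h
    by_contra! hno
    refine h ⟨A.leastInterp lam, ?_⟩
    rintro C (hC | rfl)
    · exact A.leastInterp_models lam hC
    · intro βR βS har han
      have han' := (A.freeAtom_leastInterp_iff ..).1 (han _ (Multiset.mem_singleton_self _))
      simp only [queryClause, Multiset.mem_coe, List.mem_append, or_imp, forall_and] at har
      exact absurd ((mem_toBD_iff _).1 har.1) (hno _ han')
  · rintro ⟨v, hv, hψ⟩ ⟨I, hI⟩
    obtain ⟨d⟩ := I.nonempty
    obtain ⟨β, h1, -⟩ := exists_assignment v v
    obtain rfl : (fun i => β (preVar i)) = v := funext h1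
    obtain ⟨a, ha, -⟩ := hI (queryClause lam l ψ) (.inr rfl) β (fun _ => d)
      (by
        simp only [queryClause, Multiset.mem_coe, List.mem_append, or_imp, forall_and]
        exact ⟨(mem_toBD_iff _).2 hψ, (clockBounds_holds_iff _).2 hv.inClockRange⟩)
      (by
        simp only [queryClause, Multiset.mem_singleton, forall_eq]
        exact (freeAtom_reachAtom_iff ..).2 (hv.mem_pred fun C hC => hI C (.inl hC)))
    simp [queryClause] at ha

/-! ### The encoding is a finite set of BSR(BD) clauses -/

theorem finite_bdEncoding (lam : ℕ) : (A.bdEncoding lam).Finite :=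
  ((Set.finite_singleton _).union (Set.finite_range _)).union (A.trans.finite_toSet.image _)

end TimedAutomaton

theorem ClockConstraint.exists_of_diff_mem_toBD {n : ℕ} {ψ : ClockConstraint n} {x : Fin n → ℕ}
    {y z : ℕ} {r : LARel} {c : ℚ} (h : BDAtom.diff y z r c ∈ ψ.toBD x) :
    y ∈ Set.range x ∧ z ∈ Set.range x := by
  obtain ⟨a, -, ha⟩ := List.mem_flatMap.1 h
  cases a <;> simp only [ClockAtom.toBD, List.mem_cons, List.not_mem_nil, or_false,
    BDAtom.diff.injEq, reduceCtorEq] at ha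
  obtain ⟨rfl, rfl, -⟩ := ha
  exact ⟨⟨_, rfl⟩, _, rfl⟩

theorem diff_notMem_clockBounds {n lam : ℕ} {x : Fin n → ℕ} {y z : ℕ} {r : LARel} {c : ℚ} :
    BDAtom.diff y z r c ∉ clockBounds lam x := by
  simp [clockBounds]

theorem DelayCase.exists_of_diff_mem_atoms {n lam : ℕ} {σ : DelayCase n lam}
    {y z : ℕ} {r : LARel} {c : ℚ} (h : BDAtom.diff y z r c ∈ σ.atoms) :
    (y ∈ Set.range (preVar (n := n)) ∨ y ∈ Set.range (postVar (n := n))) ∧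
      (z ∈ Set.range (preVar (n := n)) ∨ z ∈ Set.range (postVar (n := n))) := by
  simp only [DelayCase.atoms, List.mem_flatMap, List.mem_finRange, true_and, List.mem_cons,
    List.not_mem_nil, or_false, BDAtom.diff.injEq] at h
  obtain ⟨i, j, m, h⟩ := h
  rcases h with h | h | h | h <;> obtain ⟨rfl, rfl, -⟩ := h
  · exact ⟨.inl ⟨_, rfl⟩, .inl ⟨_, rfl⟩⟩
  · exact ⟨.inr ⟨_, rfl⟩, .inr ⟨_, rfl⟩⟩
  · exact ⟨.inl ⟨_, rfl⟩, .inl ⟨_, rfl⟩⟩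
  · exact ⟨.inr ⟨_, rfl⟩, .inr ⟨_, rfl⟩⟩

/-- This is where the redundant non-strict bound `x ≤ lam + 1` serves. -/
theorem BDClause.Bounds.of_clockBounds {S : Signature} {C : BDClause S} {n lam : ℕ}
    {x : Fin n → ℕ} (h : ∀ a ∈ clockBounds lam x, a ∈ C.arith) {y : ℕ} (hy : y ∈ Set.range x) :
    C.Bounds y := by
  obtain ⟨i, rfl⟩ := hy
  refine ⟨⟨0, h _ ?_⟩, ⟨(lam : ℚ) + 1, h _ ?_⟩⟩ <;>
  · simp only [clockBounds, List.mem_flatMap, List.mem_finRange, true_and]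
    exact ⟨i, by simp⟩

namespace TimedAutomaton

variable {Loc : Type} [Finite Loc] {n : ℕ} (A : TimedAutomaton Loc n)

theorem isBSRBD_initialClause (lam : ℕ) : (A.initialClause lam).IsBSRBD := by
  intro x y r c h
  have hb : ∀ a ∈ clockBounds lam (preVar (n := n)), a ∈ (A.initialClause lam).arith :=
    fun a ha => List.mem_append.2 (.inr ha)
  simp only [initialClause, Multiset.mem_coe, List.mem_append, diff_notMem_clockBounds,
    or_false] at h
  rcases h with h | h
  · simp at h
  · obtain ⟨hx, hy⟩ := ClockConstraint.exists_of_diff_mem_toBD h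
    exact ⟨.of_clockBounds hb hx, .of_clockBounds hb hy⟩

theorem isBSRBD_delayClause (lam : ℕ) (l : Loc) (σ : DelayCase n lam) :
    (A.delayClause lam l σ).IsBSRBD := by
  intro x y r c h
  have hb : ∀ a ∈ clockBounds lam (preVar (n := n)), a ∈ (A.delayClause lam l σ).arith :=
    fun a ha => List.mem_append.2 (.inl (List.mem_append.2 (.inr ha)))
  have hb' : ∀ a ∈ clockBounds lam (postVar (n := n)), a ∈ (A.delayClause lam l σ).arith :=
    fun a ha => List.mem_append.2 (.inr ha)
  simp only [delayClause, Multiset.mem_coe, List.mem_append, diff_notMem_clockBounds,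
    or_false] at h
  rcases h with (h | h) | h
  · obtain ⟨hx, hy⟩ := DelayCase.exists_of_diff_mem_atoms h
    exact ⟨hx.elim (.of_clockBounds hb) (.of_clockBounds hb'),
      hy.elim (.of_clockBounds hb) (.of_clockBounds hb')⟩
  · simp at h
  · obtain ⟨hx, hy⟩ := ClockConstraint.exists_of_diff_mem_toBD h
    exact ⟨.of_clockBounds hb' hx, .of_clockBounds hb' hy⟩

theorem isBSRBD_transitionClause (lam : ℕ) (τ : TATransition Loc n) :
    (A.transitionClause lam τ).IsBSRBD := by
  intro x y r c h
  have hb : ∀ a ∈ clockBounds lam (preVar (n := n)), a ∈ (A.transitionClause lam τ).arith :=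
    fun a ha => List.mem_append.2 (.inl (List.mem_append.2 (.inr ha)))
  have hb' : ∀ a ∈ clockBounds lam (postVar (n := n)), a ∈ (A.transitionClause lam τ).arith :=
    fun a ha => List.mem_append.2 (.inr ha)
  simp only [transitionClause, Multiset.mem_coe, List.mem_append, diff_notMem_clockBounds,
    or_false] at h
  rcases h with (h | h) | h
  · obtain ⟨hx, hy⟩ := ClockConstraint.exists_of_diff_mem_toBD h
    exact ⟨.of_clockBounds hb hx, .of_clockBounds hb hy⟩
  · obtain ⟨i, -, hi⟩ := List.mem_map.1 h
    split_ifs at hi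
  · obtain ⟨hx, hy⟩ := ClockConstraint.exists_of_diff_mem_toBD h
    exact ⟨.of_clockBounds hb' hx, .of_clockBounds hb' hy⟩

theorem isBSRBD_of_mem_bdEncoding {lam : ℕ} {C : BDClause (taSig Loc n)}
    (hC : C ∈ A.bdEncoding lam) : C.IsBSRBD := by
  rcases hC with (rfl | ⟨⟨l, σ⟩, rfl⟩) | ⟨τ, -, rfl⟩
  · exact A.isBSRBD_initialClause lam
  · exact A.isBSRBD_delayClause lam l σ
  · exact A.isBSRBD_transitionClause lam τ

end TimedAutomaton

theorem isBSRBD_queryClause {Loc : Type} [Finite Loc] {n : ℕ} (lam : ℕ) (l : Loc)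
    (ψ : ClockConstraint n) : (queryClause lam l ψ).IsBSRBD := by
  intro x y r c h
  have hb : ∀ a ∈ clockBounds lam (preVar (n := n)), a ∈ (queryClause lam l ψ).arith :=
    fun a ha => List.mem_append.2 (.inr ha)
  simp only [queryClause, Multiset.mem_coe, List.mem_append, diff_notMem_clockBounds,
    or_false] at h
  obtain ⟨hx, hy⟩ := ClockConstraint.exists_of_diff_mem_toBD h
  exact ⟨.of_clockBounds hb hx, .of_clockBounds hb hy⟩

/-- The other factors of the bound are positive, the location count because of `A.init`. Soundness
needs `lam` to dominate the constants. -/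
theorem TimedAutomaton.succ_maxConst_le_clockBound {Loc : Type} [Fintype Loc] {n : ℕ}
    (A : TimedAutomaton Loc n) (ψ : ClockConstraint n) :
    max A.maxConst ψ.maxConst + 1 ≤ A.clockBound ψ := by
  have hcard : 0 < Fintype.card Loc := Fintype.card_pos_iff.2 ⟨A.init⟩
  exact Nat.le_mul_of_pos_left _ (by positivity)

theorem theorem3 {Loc : Type} [Fintype Loc] {n : ℕ} (A : TimedAutomaton Loc n)
    (l : Loc) (ψ : ClockConstraint n) (lam : ℕ) (hlam : A.clockBound ψ ≤ lam) :
    (A.bdEncoding lam ∪ {queryClause lam l ψ}).Finite ∧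
    (∀ C ∈ A.bdEncoding lam ∪ {queryClause lam l ψ}, C.IsBSRBD) ∧
    (A.CanReach l ψ ↔
      ¬ ClauseSetSatisfiable (A.bdEncoding lam ∪ {queryClause lam l ψ})) := by
  refine ⟨(A.finite_bdEncoding lam).union (Set.finite_singleton _), ?_, ?_⟩
  · rintro C (hC | rfl)
    · exact A.isBSRBD_of_mem_bdEncoding hC
    · exact isBSRBD_queryClause lam l ψ
  · rw [A.not_satisfiable_iff]
    have hK := (A.succ_maxConst_le_clockBound ψ).trans hlam
    have hA := le_max_left A.maxConst ψ.maxConst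
    have hψ := le_max_right A.maxConst ψ.maxConst
    constructor
    · rintro ⟨v, hv, hvψ⟩
      obtain ⟨w, hw, he⟩ := hv.exists_boundedReach hA hlam
      exact ⟨w, hw, (ClockConstraint.holds_iff_of_regionEquiv he hv.nonneg
        (fun i => (hw.inClockRange i).1) hψ).1 hvψ⟩
    -- In this direction the equivalence has parameter `lam + 1`, which exceeds every constant of
    -- `ψ`.
    · rintro ⟨v, hv, hvψ⟩
      obtain ⟨w, hw, he⟩ := hv.exists_reaches (by omega)
      exact ⟨w, hw, (ClockConstraint.holds_iff_of_regionEquiv he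
        (fun i => (hv.inClockRange i).1) hw.nonneg (by omega)).1 hvψ⟩
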